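/- Let $\mathcal S=\{(p,q)\in[0,1]^2 : 0<p+q\le 1\}$. For $(p,q)\in\mathcal S$ let $E_{p,q}$ be the generalized probabilistic cellular automaton (GPCA) on $\{0,1\}^{\mathbb Z}$ defined as follows. To each $n\in\mathbb Z$ attach the neighbourhood $\mathcal N^n=\{0,1\}$ if $n$ is even and $\mathcal N^n=\{1,2\}$ if $n$ is odd. Given a configuration $\eta\in\{0,1\}^{\mathbb Z}$, the random configuration $E_{p,q}\eta$ has independent coordinates, and $E_{p,q}\eta(n)$ equals $1$ with probability $1-p$ if $\eta(n+y)=0$ for both $y\in\mathcal N^n$, and equals $1$ with probability $q$ otherwise (and equals $0$ with the complementary probability). For a probability measure $\mu$ on $\{0,1\}^{\mathbb Z}$ (with the product $\sigma$-field) let $E_{p,q}\mu$ be the law of $E_{p,q}\eta$ when $\eta$ has law $\mu$, and let $E_{p,q}^t$ be the $t$-fold iterate of this map. Call $\mu$ stationary if $E_{p,q}\mu=\mu$, and call $E_{p,q}$ ergodic if it has a unique stationary probability measure $\mu$ and, for every probability measure $\nu$ on $\{0,1\}^{\mathbb Z}$, $E_{p,q}^t\nu$ converges weakly to $\mu$ as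 $t\to\infty$. Theorem 1. The polynomial $x^5-5x^4+9x^3-8x^2+6x-1$ has a unique real root $p_0$, and $p_0\approx 0.215$ (rounded to three decimals). Moreover, for $(p,q)\in\mathcal S$, the GPCA $E_{p,q}$ is ergodic in each of the following cases: (i) $q=0$ and $p>p_0$; (ii) $q>\max\left\{\dfrac{2-p-\sqrt{p^2+2}}{2},\,0\right\}$. -/

import Mathlib

open MeasureTheory ProbabilityTheory Filter Topology

/-- A generalized probabilistic cellular automaton (GPCA) on the lattice `L` (for instance `ℤ`) with
finite alphabet `A`. Each site `x` has its own list `nbhd x` of `m` neighbourhood offsets, and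
`rule` is the common local update rule: `rule a b` is the probability that a site becomes `b` when
the states of its `m` neighbours are `a 0, …, a (m - 1)`. -/
structure GPCA (L A : Type) [Fintype A] (m : ℕ) where
  nbhd : L → Fin m → L
  rule : (Fin m → A) → A → ℝ
  rule_nonneg : ∀ a b, 0 ≤ rule a b
  rule_sum : ∀ a, ∑ b, rule a b = 1

namespace GPCA

section

variable {L A : Type} [AddCommGroup L] [Fintype A] [MeasurableSpace A]
  [MeasurableSingletonClass A] {m : ℕ} (F : GPCA L A m)

/-- The states of the neighbours `x + y`, `y` in the neighbourhood of `x`, in the configuration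
`η`. -/
def neighbours (η : L → A) (x : L) : Fin m → A :=
  fun i => η (x + F.nbhd x i)

/-- The law of the new state of the site `x`, given the current configuration `η`. -/
noncomputable def siteLaw (η : L → A) (x : L) : Measure A :=
  ∑ b, ENNReal.ofReal (F.rule (F.neighbours η x) b) • Measure.dirac b

instance isProbabilityMeasure_siteLaw (η : L → A) (x : L) :
    IsProbabilityMeasure (F.siteLaw η x) := by
  constructor
  simp only [siteLaw, Measure.coe_finsetSum, Finset.sum_apply, Measure.smul_apply, smul_eq_mul,
    measure_univ, mul_one]
  rw [← ENNReal.ofReal_sum_of_nonneg (fun b _ => F.rule_nonneg _ b), F.rule_sum,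
    ENNReal.ofReal_one]

/-- The law of the random configuration `F η`: given `η`, all sites are updated independently. -/
noncomputable def configLaw (η : L → A) : Measure (L → A) :=
  Measure.infinitePi (F.siteLaw η)

instance isProbabilityMeasure_configLaw (η : L → A) :
    IsProbabilityMeasure (F.configLaw η) := by
  unfold configLaw
  infer_instance

lemma measurable_siteLaw_apply (x : L) (s : Set A) :
    Measurable fun η : L → A => F.siteLaw η x s := by
  have h : Measurable fun a : Fin m → A =>
      (∑ b, ENNReal.ofReal (F.rule a b) • Measure.dirac b : Measure A) s :=
    measurable_of_countable _
  exact h.comp (measurable_pi_lambda _ fun i => measurable_pi_apply _)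

lemma measurable_configLaw : Measurable F.configLaw := by
  refine Measurable.measure_of_isPiSystem_of_isProbabilityMeasure
    (generateFrom_squareCylinders (α := fun _ : L => A)).symm
    (isPiSystem_squareCylinders (fun _ => MeasurableSpace.isPiSystem_measurableSet) (by simp)) ?_
  rintro _ ⟨I, t, ht, rfl⟩
  have ht' : ∀ i, MeasurableSet (t i) := fun i => ht i (Set.mem_univ i)
  have h : ∀ η : L → A, F.configLaw η (Set.pi I t) = ∏ i ∈ I, F.siteLaw η i (t i) :=
    fun η => Measure.infinitePi_pi _ (fun i _ => ht' i)
  simp only [h]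
  exact Finset.measurable_prod _ fun i _ => F.measurable_siteLaw_apply i (t i)

/-- The one-step transition kernel of the GPCA on configurations. -/
noncomputable def kernel : Kernel (L → A) (L → A) where
  toFun := F.configLaw
  measurable' := F.measurable_configLaw

instance isMarkovKernel_kernel : IsMarkovKernel F.kernel :=
  ⟨fun η => F.isProbabilityMeasure_configLaw η⟩

/-- The action `μ ↦ F μ` of the GPCA on probability measures on the space of configurations. -/
noncomputable def act (μ : ProbabilityMeasure (L → A)) : ProbabilityMeasure (L → A) :=
  ⟨(μ : Measure (L → A)).bind F.kernel, inferInstance⟩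

/-- `μ` is stationary for `F` if `F μ = μ`. -/
def IsStationary (μ : ProbabilityMeasure (L → A)) : Prop :=
  F.act μ = μ

/-- `F` is ergodic if it has a unique stationary measure `μ`, and `F ^ t ν` converges weakly to `μ`
as `t → ∞` for every probability measure `ν` on the space of configurations (which carries the
product topology). -/
def IsErgodic [TopologicalSpace A] [OpensMeasurableSpace (L → A)] : Prop :=
  ∃ μ : ProbabilityMeasure (L → A),
    F.IsStationary μ ∧ (∀ ν, F.IsStationary ν → ν = μ) ∧
      ∀ ν : ProbabilityMeasure (L → A), Tendsto (fun t : ℕ => F.act^[t] ν) atTop (𝓝 μ)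

end

end GPCA

/-- The parameter space `{(p, q) ∈ [0, 1]² : 0 < p + q ≤ 1}`. -/
def paramSet : Set (ℝ × ℝ) :=
  {z | z.1 ∈ Set.Icc (0 : ℝ) 1 ∧ z.2 ∈ Set.Icc (0 : ℝ) 1 ∧ 0 < z.1 + z.2 ∧ z.1 + z.2 ≤ 1}

/-- The neighbourhoods `{0, 1}` at even sites and `{1, 2}` at odd sites. -/
def parityNbhd (x : ℤ) : Fin 2 → ℤ :=
  if Even x then ![0, 1] else ![1, 2]

/-- The probability that a site becomes `1`: it is `1 - p` if both neighbours are `0`, and `q`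
otherwise. -/
noncomputable def probOne (p q : ℝ) (a : Fin 2 → Fin 2) : ℝ :=
  if a 0 = 0 ∧ a 1 = 0 then 1 - p else q

/-- The GPCA `E_{p,q}` on `ℤ` with alphabet `{0, 1}`. -/
noncomputable def gpcaE (p q : ℝ) (h : (p, q) ∈ paramSet) : GPCA ℤ (Fin 2) 2 where
  nbhd := parityNbhd
  rule a b := if b = 1 then probOne p q a else 1 - probOne p q a
  rule_nonneg a b := by
    obtain ⟨⟨h1, h2⟩, ⟨h3, h4⟩, -, -⟩ := h
    simp only at h1 h2 h3 h4
    unfold probOne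
    split_ifs <;> linarith
  rule_sum a := by simp

/-!
Site `n` of the automaton reads a block `{2k, 2k + 1}`, and only through the question whether this
block is empty; each block is read by two sites, which lie in two different new blocks. The
automaton can be driven by independent noise at the sites, with values "become `0`", "become `1`" and
"negate" of probabilities `p`, `q` and `1 - p - q` (`configLaw_gpcaE`). With this noise fixed, one can
run the *envelope* process: the same dynamics on blocks whose state may be unknown, written `?` (and
encoded as `2`). Started from the totally unknown configuration it bounds the influence of the
initial configuration (`abs_iterate_average_sub_le`), so the automaton is ergodic as soon as the
density of unknown blocks tends to `0` (`isErgodic_of_tendsto_expect`). Passing from vanishing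
oscillations of local functions to ergodicity is a compactness argument (`isErgodic_of_tendsto_sub`).

The law of the envelope process is invariant under reflections, hence under translations, so its
block probabilities satisfy the obvious symmetries. An unknown block makes each of its two readers
unknown with probability at most `(1 - p - q) (1 - q)`. If `2 (1 - p - q) (1 - q) < 1`, which is the
condition on `q` in the second part, and for `q = 0` the condition `p > 1 / 2`, the density decays
exponentially (`isErgodic_of_contraction`).

For `q = 0` and `p ≤ 1 / 2` the crude count fails for patterns such as `1?1`, where both readers of
the unknown block are likely to be unknown. But with `q = 0` a new block can be `1` only if it reads
a `0`, so the pattern `?1` is not reproduced easily. This is quantified by adding to the density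
multiples of the probabilities of `?1` and `?10`: the weight
`P(?) + (1.01 - 2p) P(?1) + 1/2 P(?10)` decreases by at least a multiple of `P(?)` at each step as
soon as `p > 0.2145` (`exists_weight_decrease`), so that the densities are summable. The root of the
quintic polynomial lies between `0.2145` and `0.2155`.
-/

namespace ParityGPCA

/-! ### Local functions of a configuration -/

section Local

variable {A : Type}

/-- A real function of a configuration is local if it only reads finitely many sites. -/
def IsLocal (g : (ℤ → A) → ℝ) : Prop :=
  ∃ S : Finset ℤ, DependsOn g (S : Set ℤ)

lemma IsLocal.add {g h : (ℤ → A) → ℝ} (hg : IsLocal g) (hh : IsLocal h) :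
    IsLocal fun η => g η + h η := by
  obtain ⟨S, hS⟩ := hg
  obtain ⟨T, hT⟩ := hh
  refine ⟨S ∪ T, fun η ζ e => ?_⟩
  have h1 := hS fun i hi => e i (by simp [Finset.mem_coe.1 hi])
  have h2 := hT fun i hi => e i (by simp [Finset.mem_coe.1 hi])
  simp only [h1, h2]

lemma IsLocal.const_mul {g : (ℤ → A) → ℝ} (hg : IsLocal g) (c : ℝ) :
    IsLocal fun η => c * g η := by
  obtain ⟨S, hS⟩ := hg
  exact ⟨S, fun η ζ e => by simp only [hS e]⟩

lemma IsLocal.sum {ι : Type*} (s : Finset ι) {g : ι → (ℤ → A) → ℝ} (hg : ∀ i, IsLocal (g i)) :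
    IsLocal fun η => ∑ i ∈ s, g i η := by
  classical
  choose S hS using hg
  refine ⟨s.biUnion S, fun η ζ e => Finset.sum_congr rfl fun i hi => hS i fun j hj => e j ?_⟩
  exact Finset.mem_coe.2 (Finset.mem_biUnion.2 ⟨i, hi, Finset.mem_coe.1 hj⟩)

lemma isLocal_eval (f : A → ℝ) (k : ℤ) : IsLocal fun η : ℤ → A => f (η k) :=
  ⟨{k}, fun η ζ e => by simp only [e k (by simp)]⟩

lemma isLocal_eval₃ (f : A → A → A → ℝ) (i j k : ℤ) :
    IsLocal fun η : ℤ → A => f (η i) (η j) (η k) :=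
  ⟨{i, j, k}, fun η ζ e => by simp only [e i (by simp), e j (by simp), e k (by simp)]⟩

lemma IsLocal.exists_restrict {g : (ℤ → A) → ℝ} (hg : IsLocal g) :
    ∃ (S : Finset ℤ) (g' : (S → A) → ℝ), ∀ η, g η = g' fun i => η i := by
  obtain ⟨S, hS⟩ := hg
  obtain ⟨g', h⟩ := dependsOn_iff_exists_comp.1 hS
  exact ⟨S, g', fun η => congrFun h η⟩

lemma IsLocal.continuous [TopologicalSpace A] [DiscreteTopology A]
    {g : (ℤ → A) → ℝ} (hg : IsLocal g) : Continuous g := by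
  obtain ⟨S, g', h⟩ := hg.exists_restrict
  have : g = g' ∘ fun η i => η i := funext h
  rw [this]
  exact (continuous_of_discreteTopology (f := g')).comp (by fun_prop)

/-- Local functions separate probability measures, because they include the indicators of
cylinders. -/
lemma probabilityMeasure_ext_of_integral_isLocal [MeasurableSpace A] [MeasurableSingletonClass A]
    {μ ν : ProbabilityMeasure (ℤ → A)}
    (h : ∀ g : (ℤ → A) → ℝ, IsLocal g →
      ∫ η, g η ∂(μ : Measure (ℤ → A)) = ∫ η, g η ∂(ν : Measure (ℤ → A))) : μ = ν := by
  classical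
  refine ProbabilityMeasure.toMeasure_injective ?_
  refine ext_of_generate_finite _ (generateFrom_squareCylinders (α := fun _ : ℤ => A)).symm
    (isPiSystem_squareCylinders (fun _ => MeasurableSpace.isPiSystem_measurableSet) (by simp)) ?_
    (by simp)
  rintro _ ⟨I, t, ht, rfl⟩
  have hm : MeasurableSet (Set.pi (I : Set ℤ) t) :=
    .pi I.countable_toSet fun i _ => ht i (Set.mem_univ i)
  have hl : IsLocal ((Set.pi (I : Set ℤ) t).indicator fun _ => (1 : ℝ)) := by
    refine ⟨I, fun η ζ e => ?_⟩
    have : η ∈ Set.pi (I : Set ℤ) t ↔ ζ ∈ Set.pi (I : Set ℤ) t := by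
      simp only [Set.mem_pi]
      exact forall₂_congr fun i hi => by rw [e i hi]
    simp only [Set.indicator, this]
  have := h _ hl
  rw [integral_indicator_const _ hm, integral_indicator_const _ hm] at this
  simpa [measureReal_def, ENNReal.toReal_eq_toReal_iff' (measure_ne_top _ _) (measure_ne_top _ _)]
    using this

variable [Finite A]

lemma IsLocal.exists_abs_le {g : (ℤ → A) → ℝ} (hg : IsLocal g) : ∃ C, ∀ η, |g η| ≤ C := by
  obtain ⟨S, g', h⟩ := hg.exists_restrict
  obtain ⟨C, hC⟩ := (Set.finite_range fun x => |g' x|).bddAbove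
  exact ⟨C, fun η => h η ▸ hC ⟨_, rfl⟩⟩

/-- Integration of a local function is weakly continuous. -/
lemma IsLocal.continuous_integral [MeasurableSpace A] [TopologicalSpace A] [DiscreteTopology A] [BorelSpace A]
    {g : (ℤ → A) → ℝ} (hg : IsLocal g) :
    Continuous fun μ : ProbabilityMeasure (ℤ → A) => ∫ η, g η ∂(μ : Measure (ℤ → A)) := by
  obtain ⟨C, hC⟩ := hg.exists_abs_le
  exact ProbabilityMeasure.continuous_integral_boundedContinuousFunction
    (BoundedContinuousFunction.ofNormedAddCommGroup g hg.continuous C hC)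

lemma IsLocal.measurable [MeasurableSpace A] [MeasurableSingletonClass A]
    {g : (ℤ → A) → ℝ} (hg : IsLocal g) : Measurable g := by
  obtain ⟨S, g', h⟩ := hg.exists_restrict
  have : g = g' ∘ fun η i => η i := funext h
  rw [this]
  exact (measurable_of_countable g').comp (by fun_prop)

lemma IsLocal.integrable [MeasurableSpace A] [MeasurableSingletonClass A]
    {g : (ℤ → A) → ℝ} (hg : IsLocal g) (μ : Measure (ℤ → A)) [IsFiniteMeasure μ] :
    Integrable g μ := by
  obtain ⟨C, hC⟩ := hg.exists_abs_le
  exact Integrable.of_bound hg.measurable.aestronglyMeasurable C (ae_of_all _ hC)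

/-- Local functions of disjoint sets of coordinates are uncorrelated under a product measure. -/
lemma integral_mul_of_dependsOn_disjoint [MeasurableSpace A] [MeasurableSingletonClass A]
    (ν : Measure A) [IsProbabilityMeasure ν] {f g : (ℤ → A) → ℝ} {S T : Finset ℤ}
    (hf : DependsOn f (S : Set ℤ)) (hg : DependsOn g (T : Set ℤ)) (hST : Disjoint S T) :
    ∫ ω, f ω * g ω ∂Measure.infinitePi (fun _ : ℤ => ν) =
      (∫ ω, f ω ∂Measure.infinitePi (fun _ : ℤ => ν)) *
        ∫ ω, g ω ∂Measure.infinitePi (fun _ : ℤ => ν) := by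
  obtain ⟨f', rfl⟩ := dependsOn_iff_exists_comp.1 hf
  obtain ⟨g', rfl⟩ := dependsOn_iff_exists_comp.1 hg
  have hi : iIndepFun (fun (i : ℤ) (ω : ℤ → A) => ω i) (Measure.infinitePi fun _ : ℤ => ν) :=
    iIndepFun_infinitePi (P := fun _ : ℤ => ν) (X := fun _ a => a) fun _ => measurable_id
  have h := hi.indepFun_finset S T hST fun i => measurable_pi_apply i
  exact IndepFun.integral_fun_comp_mul_comp (f := f') (g := g') h (by fun_prop) (by fun_prop)
    (measurable_of_countable f').aestronglyMeasurable
    (measurable_of_countable g').aestronglyMeasurable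

end Local

/-! ### Averaging over one step of a random map -/

section Average

variable {A B : Type}

/-- A random map `(η, ω) ↦ Φ η ω` of configurations is local if each site of the new configuration
reads only finitely many sites of the old configuration and of the noise. -/
def IsLocalMap (Φ : (ℤ → A) → (ℤ → B) → ℤ → A) : Prop :=
  ∃ R : ℤ → Finset ℤ, ∀ n η ζ ω ω', (∀ m ∈ R n, η m = ζ m) → (∀ m ∈ R n, ω m = ω' m) →
    Φ η ω n = Φ ζ ω' n

/-- The operator `g ↦ (η ↦ 𝔼 g (Φ η ω))` of one random step driven by the noise law `P`. -/
noncomputable def average [MeasurableSpace B] (P : Measure (ℤ → B))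
    (Φ : (ℤ → A) → (ℤ → B) → ℤ → A) (g : (ℤ → A) → ℝ) (η : ℤ → A) : ℝ :=
  ∫ ω, g (Φ η ω) ∂P

variable {Φ : (ℤ → A) → (ℤ → B) → ℤ → A}

lemma IsLocalMap.isLocal_noise (hΦ : IsLocalMap Φ) {g : (ℤ → A) → ℝ} (hg : IsLocal g)
    (η : ℤ → A) : IsLocal fun ω => g (Φ η ω) := by
  classical
  obtain ⟨R, hR⟩ := hΦ
  obtain ⟨S, hS⟩ := hg
  refine ⟨S.biUnion R, fun ω ω' e => hS fun n hn => hR n η η ω ω' (fun _ _ => rfl) fun m hm => ?_⟩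
  exact e m (Finset.mem_coe.2 (Finset.mem_biUnion.2 ⟨n, Finset.mem_coe.1 hn, hm⟩))

variable [MeasurableSpace B] {P : Measure (ℤ → B)}

lemma IsLocalMap.isLocal_average (hΦ : IsLocalMap Φ) {g : (ℤ → A) → ℝ} (hg : IsLocal g) :
    IsLocal (average P Φ g) := by
  classical
  obtain ⟨R, hR⟩ := hΦ
  obtain ⟨S, hS⟩ := hg
  refine ⟨S.biUnion R, fun η ζ e => integral_congr_ae (ae_of_all _ fun ω => ?_)⟩
  refine hS fun n hn => hR n η ζ ω ω (fun m hm => ?_) fun _ _ => rfl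
  exact e m (Finset.mem_coe.2 (Finset.mem_biUnion.2 ⟨n, Finset.mem_coe.1 hn, hm⟩))

lemma IsLocalMap.isLocal_iterate_average (hΦ : IsLocalMap Φ) {g : (ℤ → A) → ℝ} (hg : IsLocal g)
    (t : ℕ) : IsLocal ((average P Φ)^[t] g) := by
  induction t with
  | zero => exact hg
  | succ t ih =>
    rw [Function.iterate_succ_apply']
    exact hΦ.isLocal_average ih

lemma average_const_mul (g : (ℤ → A) → ℝ) (c : ℝ) :
    average P Φ (fun η => c * g η) = fun η => c * average P Φ g η :=
  funext fun _ => integral_const_mul c _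

lemma iterate_average_const_mul (g : (ℤ → A) → ℝ) (c : ℝ) (t : ℕ) (η : ℤ → A) :
    (average P Φ)^[t] (fun η => c * g η) η = c * (average P Φ)^[t] g η := by
  induction t generalizing g with
  | zero => rfl
  | succ t ih =>
    simp only [Function.iterate_succ_apply, average_const_mul]
    exact ih _

variable [Finite B] [MeasurableSingletonClass B] [IsProbabilityMeasure P]

lemma IsLocalMap.integrable (hΦ : IsLocalMap Φ) {g : (ℤ → A) → ℝ} (hg : IsLocal g) (η : ℤ → A) :
    Integrable (fun ω => g (Φ η ω)) P :=
  (hΦ.isLocal_noise hg η).integrable P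

lemma average_add (hΦ : IsLocalMap Φ) {g h : (ℤ → A) → ℝ} (hg : IsLocal g) (hh : IsLocal h) :
    average P Φ (fun η => g η + h η) = fun η => average P Φ g η + average P Φ h η :=
  funext fun η => integral_add (hΦ.integrable hg η) (hΦ.integrable hh η)

lemma iterate_average_mono (hΦ : IsLocalMap Φ) {g h : (ℤ → A) → ℝ} (hg : IsLocal g)
    (hh : IsLocal h) (le : ∀ η, g η ≤ h η) (t : ℕ) (η : ℤ → A) :
    (average P Φ)^[t] g η ≤ (average P Φ)^[t] h η := by
  induction t generalizing η with
  | zero => exact le η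
  | succ t ih =>
    simp only [Function.iterate_succ_apply']
    exact integral_mono (hΦ.integrable (hΦ.isLocal_iterate_average hg t) η)
      (hΦ.integrable (hΦ.isLocal_iterate_average hh t) η) fun ω => ih _

lemma iterate_average_add (hΦ : IsLocalMap Φ) {g h : (ℤ → A) → ℝ} (hg : IsLocal g)
    (hh : IsLocal h) (t : ℕ) (η : ℤ → A) :
    (average P Φ)^[t] (fun η => g η + h η) η =
      (average P Φ)^[t] g η + (average P Φ)^[t] h η := by
  induction t generalizing g h with
  | zero => rfl
  | succ t ih =>
    simp only [Function.iterate_succ_apply, average_add hΦ hg hh]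
    exact ih (hΦ.isLocal_average hg) (hΦ.isLocal_average hh)

lemma iterate_average_sum (hΦ : IsLocalMap Φ) {ι : Type*} (s : Finset ι)
    {g : ι → (ℤ → A) → ℝ} (hg : ∀ i, IsLocal (g i)) (t : ℕ) (η : ℤ → A) :
    (average P Φ)^[t] (fun η => ∑ i ∈ s, g i η) η = ∑ i ∈ s, (average P Φ)^[t] (g i) η := by
  classical
  induction s using Finset.induction_on with
  | empty =>
    have := iterate_average_const_mul (P := P) (Φ := Φ) (fun _ => 0) 0 t η
    simpa using this
  | insert i s hi ih =>
    simp only [Finset.sum_insert hi]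
    rw [iterate_average_add hΦ (hg i) (.sum s hg), ih]

end Average

/-! ### A criterion for ergodicity -/

section Ergodic

lemma eq_of_tendsto_of_mapClusterPt {X ι : Type*} [TopologicalSpace X] [T2Space X] {l : Filter ι}
    {f : ι → X} {x y : X} (h : Tendsto f l (𝓝 x)) (h' : MapClusterPt y l f) : x = y := by
  have : (𝓝 y ⊓ 𝓝 x).NeBot := h'.clusterPt.mono h
  exact (eq_of_nhds_neBot this).symm

variable {A : Type} [Fintype A] [MeasurableSpace A] [MeasurableSingletonClass A] {m : ℕ}
  (F : GPCA ℤ A m) {B : Type} [MeasurableSpace B] {P : Measure (ℤ → B)}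
  {Φ : (ℤ → A) → (ℤ → B) → ℤ → A}

/-- `average P Φ` is the dual of the action of `F` if the noise law `P` and the map `Φ` realise the
transition kernel of `F`. -/
lemma integral_act (hF : ∀ η, F.configLaw η = P.map (Φ η)) (hm : ∀ η, Measurable (Φ η))
    (ν : ProbabilityMeasure (ℤ → A)) {g : (ℤ → A) → ℝ} (hg : IsLocal g) :
    ∫ η, g η ∂(F.act ν : Measure (ℤ → A)) = ∫ η, average P Φ g η ∂(ν : Measure (ℤ → A)) := by
  have h : ((F.act ν : ProbabilityMeasure (ℤ → A)) : Measure (ℤ → A)) =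
      (ν : Measure (ℤ → A)).bind F.kernel := rfl
  have hi : Integrable g ((F.kernel ∘ₖ Kernel.const Unit (ν : Measure (ℤ → A))) ()) := by
    rw [← Measure.comp_eq_comp_const_apply]
    exact hg.integrable _
  rw [h, Measure.comp_eq_comp_const_apply, Kernel.integral_comp hi, Kernel.const_apply]
  refine integral_congr_ae (ae_of_all _ fun η => ?_)
  change ∫ x, g x ∂F.configLaw η = _
  rw [hF η, integral_map (hm η).aemeasurable hg.measurable.aestronglyMeasurable]
  rfl

lemma integral_iterate_act (hΦ : IsLocalMap Φ) (hF : ∀ η, F.configLaw η = P.map (Φ η))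
    (hm : ∀ η, Measurable (Φ η)) (ν : ProbabilityMeasure (ℤ → A)) {g : (ℤ → A) → ℝ}
    (hg : IsLocal g) (t : ℕ) :
    ∫ η, g η ∂(F.act^[t] ν : Measure (ℤ → A)) =
      ∫ η, (average P Φ)^[t] g η ∂(ν : Measure (ℤ → A)) := by
  induction t generalizing ν with
  | zero => rfl
  | succ t ih =>
    rw [Function.iterate_succ_apply, ih, integral_act F hF hm ν (hΦ.isLocal_iterate_average hg t),
      Function.iterate_succ_apply']

/-- Two averages of a function of small oscillation are close. -/
lemma abs_integral_sub_integral_le {g : (ℤ → A) → ℝ} (hg : IsLocal g) {ε : ℝ}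
    (h : ∀ η ζ, |g η - g ζ| ≤ ε) (μ ν : ProbabilityMeasure (ℤ → A)) :
    |∫ η, g η ∂(μ : Measure (ℤ → A)) - ∫ η, g η ∂(ν : Measure (ℤ → A))| ≤ ε := by
  have key : ∀ μ ν : ProbabilityMeasure (ℤ → A),
      ∫ η, g η ∂(μ : Measure (ℤ → A)) ≤ ∫ η, g η ∂(ν : Measure (ℤ → A)) + ε := fun μ ν => by
    have h1 : ∀ η, g η ≤ ∫ ζ, g ζ ∂(ν : Measure (ℤ → A)) + ε := fun η => by
      have := integral_mono (μ := (ν : Measure (ℤ → A))) (integrable_const (g η - ε))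
        (hg.integrable _) fun ζ => by linarith [(abs_le.1 (h η ζ)).2]
      simp at this
      linarith
    have := integral_mono (μ := (μ : Measure (ℤ → A))) (hg.integrable _)
      (integrable_const (∫ ζ, g ζ ∂(ν : Measure (ℤ → A)) + ε)) h1
    simpa using this
  rw [abs_le]
  constructor <;> linarith [key μ ν, key ν μ]

/-- A GPCA forgets its initial configuration, hence is ergodic, if for every local function the
means under two evolving laws become close. Existence of a stationary measure comes from
compactness of the space of probability measures. -/
theorem isErgodic_of_tendsto_sub [TopologicalSpace A] [DiscreteTopology A] [BorelSpace A]
    [Nonempty A] (hloc : ∀ g : (ℤ → A) → ℝ, IsLocal g → ∃ h : (ℤ → A) → ℝ, IsLocal h ∧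
      ∀ ν, ∫ η, g η ∂(F.act ν : Measure (ℤ → A)) = ∫ η, h η ∂(ν : Measure (ℤ → A)))
    (close : ∀ (μ ν : ProbabilityMeasure (ℤ → A)) (g : (ℤ → A) → ℝ), IsLocal g →
      Tendsto (fun t => ∫ η, g η ∂(F.act^[t] μ : Measure (ℤ → A)) -
        ∫ η, g η ∂(F.act^[t] ν : Measure (ℤ → A))) atTop (𝓝 0)) :
    F.IsErgodic := by
  let ν₀ : ProbabilityMeasure (ℤ → A) :=
    ⟨Measure.dirac fun _ => Classical.arbitrary A, inferInstance⟩
  obtain ⟨μ, hμ⟩ := exists_clusterPt_of_compactSpace (map (fun t => F.act^[t] ν₀) atTop)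
  have hstat : F.act μ = μ := by
    refine probabilityMeasure_ext_of_integral_isLocal fun g hg => ?_
    obtain ⟨h, hh, hgh⟩ := hloc g hg
    have h1 := hh.continuous_integral.sub hg.continuous_integral
    have h2 := MapClusterPt.continuousAt_comp h1.continuousAt hμ
    have h3 := close (F.act ν₀) ν₀ g hg
    have e : ∀ t, ∫ η, g η ∂(F.act^[t] (F.act ν₀) : Measure (ℤ → A)) =
        ∫ η, h η ∂(F.act^[t] ν₀ : Measure (ℤ → A)) := fun t => by
      rw [← Function.iterate_succ_apply, Function.iterate_succ_apply', hgh]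
    simp only [e] at h3
    rw [hgh]
    exact sub_eq_zero.1 (eq_of_tendsto_of_mapClusterPt h3 h2).symm
  have hconv : ∀ ν : ProbabilityMeasure (ℤ → A),
      Tendsto (fun t : ℕ => F.act^[t] ν) atTop (𝓝 μ) := fun ν => by
    refine tendsto_nhds_of_unique_mapClusterPt fun μ' h' => ?_
    refine probabilityMeasure_ext_of_integral_isLocal fun g hg => ?_
    have h3 := close ν μ g hg
    simp only [Function.iterate_fixed hstat] at h3
    have h4 := h3.add_const (∫ η, g η ∂(μ : Measure (ℤ → A)))
    simp only [sub_add_cancel, zero_add] at h4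
    have h5 := MapClusterPt.continuousAt_comp hg.continuous_integral.continuousAt h'
    exact (eq_of_tendsto_of_mapClusterPt h4 h5).symm
  refine ⟨μ, hstat, fun ν hν => ?_, hconv⟩
  have h := hconv ν
  have e : ∀ t : ℕ, F.act^[t] ν = ν := fun t => Function.iterate_fixed hν t
  simp only [e] at h
  exact tendsto_nhds_unique tendsto_const_nhds h

/-- A GPCA is ergodic if the oscillation of every local function tends to zero along the
dynamics. -/
theorem isErgodic_of_oscillation [TopologicalSpace A] [DiscreteTopology A] [BorelSpace A]
    [Nonempty A] (hΦ : IsLocalMap Φ)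
    (hF : ∀ η, F.configLaw η = P.map (Φ η)) (hm : ∀ η, Measurable (Φ η))
    (osc : ∀ g : (ℤ → A) → ℝ, IsLocal g → ∃ e : ℕ → ℝ, Tendsto e atTop (𝓝 0) ∧
      ∀ t η ζ, |(average P Φ)^[t] g η - (average P Φ)^[t] g ζ| ≤ e t) :
    F.IsErgodic := by
  refine isErgodic_of_tendsto_sub F
    (fun g hg => ⟨average P Φ g, hΦ.isLocal_average hg, fun ν => integral_act F hF hm ν hg⟩)
    fun μ ν g hg => ?_
  obtain ⟨e, he, h⟩ := osc g hg
  refine squeeze_zero_norm (fun t => ?_) he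
  rw [integral_iterate_act F hΦ hF hm μ hg, integral_iterate_act F hΦ hF hm ν hg]
  exact abs_integral_sub_integral_le (hΦ.isLocal_iterate_average hg t) (h t) μ ν

end Ergodic

/-! ### The noise driving the automaton -/

/-- The law of the noise at a site: `0` with probability `p` (the new state is forced to be `0`),
`1` with probability `q` (it is forced to be `1`), and `2` otherwise (it is the negation of the
disjunction of the two neighbours). -/
noncomputable def noiseLaw (p q : ℝ) : Measure (Fin 3) :=
  ENNReal.ofReal p • Measure.dirac 0 + ENNReal.ofReal q • Measure.dirac 1 +
    ENNReal.ofReal (1 - p - q) • Measure.dirac 2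

lemma isProbabilityMeasure_noiseLaw {p q : ℝ} (h : (p, q) ∈ paramSet) :
    IsProbabilityMeasure (noiseLaw p q) := by
  obtain ⟨⟨hp, -⟩, ⟨hq, -⟩, -, hr⟩ := h
  simp only at hp hq hr
  constructor
  simp only [noiseLaw, Measure.add_apply, Measure.smul_apply, measure_univ, smul_eq_mul, mul_one]
  rw [← ENNReal.ofReal_add hp hq, ← ENNReal.ofReal_add (by positivity) (by linarith)]
  simp

lemma integral_noiseLaw {p q : ℝ} (h : (p, q) ∈ paramSet) (f : Fin 3 → ℝ) :
    ∫ x, f x ∂noiseLaw p q = p * f 0 + q * f 1 + (1 - p - q) * f 2 := by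
  obtain ⟨⟨hp, -⟩, ⟨hq, -⟩, -, hr⟩ := h
  simp only at hp hq hr
  have hi : ∀ (c : ℝ) (a : Fin 3), Integrable f (ENNReal.ofReal c • Measure.dirac a) :=
    fun c a => (integrable_dirac (by simp)).smul_measure ENNReal.ofReal_ne_top
  rw [noiseLaw, integral_add_measure ((hi _ _).add_measure (hi _ _)) (hi _ _),
    integral_add_measure (hi _ _) (hi _ _)]
  simp only [integral_smul_measure, integral_dirac, smul_eq_mul]
  rw [ENNReal.toReal_ofReal hp, ENNReal.toReal_ofReal hq, ENNReal.toReal_ofReal (by linarith)]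

/-- The law of the whole noise configuration. -/
noncomputable abbrev noise (p q : ℝ) : Measure (ℤ → Fin 3) :=
  Measure.infinitePi fun _ => noiseLaw p q

/-- The new state of a site whose neighbours are both `0` (`b = true`) or not (`b = false`). -/
def update (b : Bool) (x : Fin 3) : Fin 2 :=
  if x = 2 then (if b then 1 else 0) else if x = 1 then 1 else 0

/-- The `k`-th block `{2k, 2k + 1}` of `η` is empty: both its sites are in state `0`. -/
def emptyBlock (η : ℤ → Fin 2) (k : ℤ) : Bool :=
  decide (η (2 * k) = 0 ∧ η (2 * k + 1) = 0)

/-- One step of the automaton as a function of the noise. Both the even site `2k` and the odd site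
`2k - 1` read the `k`-th block, which has index `(n + 1) / 2` for these two values of `n`. -/
def step (η : ℤ → Fin 2) (ω : ℤ → Fin 3) (n : ℤ) : Fin 2 :=
  update (emptyBlock η ((n + 1) / 2)) (ω n)

lemma isLocalMap_step : IsLocalMap step := by
  refine ⟨fun n => {n, 2 * ((n + 1) / 2), 2 * ((n + 1) / 2) + 1}, fun n η ζ ω ω' h h' => ?_⟩
  simp only [step, emptyBlock]
  rw [h' n (by simp), h (2 * ((n + 1) / 2)) (by simp), h (2 * ((n + 1) / 2) + 1) (by simp)]

lemma measurable_step (η : ℤ → Fin 2) : Measurable (step η) :=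
  measurable_pi_lambda _ fun n => (measurable_of_countable _).comp (measurable_pi_apply n)

lemma neighbours_gpcaE {p q : ℝ} (h : (p, q) ∈ paramSet) (η : ℤ → Fin 2) (n : ℤ) :
    ((gpcaE p q h).neighbours η n 0 = 0 ∧ (gpcaE p q h).neighbours η n 1 = 0) ↔
      emptyBlock η ((n + 1) / 2) = true := by
  rcases Int.even_or_odd n with hn | hn
  · have e : (n + 1) / 2 * 2 = n := by obtain ⟨k, rfl⟩ := hn; omega
    simp [GPCA.neighbours, gpcaE, parityNbhd, hn, emptyBlock, mul_comm (2 : ℤ), e]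
  · have e : (n + 1) / 2 * 2 = n + 1 := by obtain ⟨k, rfl⟩ := hn; omega
    have e' : n + 1 + 1 = n + 2 := by ring
    simp [GPCA.neighbours, gpcaE, parityNbhd, Int.not_even_iff_odd.2 hn, emptyBlock,
      mul_comm (2 : ℤ), e, e']

lemma siteLaw_gpcaE {p q : ℝ} (h : (p, q) ∈ paramSet) (η : ℤ → Fin 2) (n : ℤ) :
    (gpcaE p q h).siteLaw η n =
      (noiseLaw p q).map (update (emptyBlock η ((n + 1) / 2))) := by
  have h0 : (gpcaE p q h).rule ((gpcaE p q h).neighbours η n) 0 =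
      1 - if emptyBlock η ((n + 1) / 2) = true then 1 - p else q :=
    congrArg (1 - ·) (if_congr (neighbours_gpcaE h η n) rfl rfl)
  have h1 : (gpcaE p q h).rule ((gpcaE p q h).neighbours η n) 1 =
      if emptyBlock η ((n + 1) / 2) = true then 1 - p else q :=
    if_congr (neighbours_gpcaE h η n) rfl rfl
  obtain ⟨⟨hp, -⟩, ⟨hq, -⟩, -, hr⟩ := id h
  simp only at hp hq hr
  have hu : ∀ b, Measurable (update b) := fun _ => measurable_of_countable _
  have e1 : ENNReal.ofReal (1 - q) = ENNReal.ofReal p + ENNReal.ofReal (1 - p - q) := by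
    rw [← ENNReal.ofReal_add hp (by linarith)]
    congr 1
    ring
  have e2 : ENNReal.ofReal (1 - p) = ENNReal.ofReal q + ENNReal.ofReal (1 - p - q) := by
    rw [← ENNReal.ofReal_add hq (by linarith)]
    congr 1
    ring
  rw [GPCA.siteLaw, Fin.sum_univ_two, h0, h1, noiseLaw, Measure.map_add _ _ (hu _),
    Measure.map_add _ _ (hu _)]
  simp only [Measure.map_smul, Measure.map_dirac' (hu _)]
  cases emptyBlock η ((n + 1) / 2)
  · have u0 : update false 0 = 0 := rfl
    have u1 : update false 1 = 1 := rfl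
    have u2 : update false 2 = 0 := rfl
    rw [if_neg (by simp), u0, u1, u2, e1, add_smul, add_right_comm]
  · have u0 : update true 0 = 0 := rfl
    have u1 : update true 1 = 1 := rfl
    have u2 : update true 2 = 1 := rfl
    rw [if_pos rfl, u0, u1, u2, sub_sub_cancel, e2, add_smul, add_assoc]

/-- The configuration law of the automaton is the law of `step` driven by independent noise. -/
lemma configLaw_gpcaE {p q : ℝ} (h : (p, q) ∈ paramSet) (η : ℤ → Fin 2) :
    (gpcaE p q h).configLaw η = (noise p q).map (step η) := by
  have := isProbabilityMeasure_noiseLaw h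
  have e : (noise p q).map (step η) = Measure.infinitePi fun n =>
      (noiseLaw p q).map (update (emptyBlock η ((n + 1) / 2))) :=
    Measure.infinitePi_map_pi (μ := fun _ : ℤ => noiseLaw p q)
      (f := fun n => update (emptyBlock η ((n + 1) / 2))) fun _ => measurable_of_countable _
  have hs : (gpcaE p q h).siteLaw η = fun n =>
      (noiseLaw p q).map (update (emptyBlock η ((n + 1) / 2))) :=
    funext fun n => siteLaw_gpcaE h η n
  rw [e, GPCA.configLaw]
  simp only [hs]

/-! ### The envelope process on blocks -/

/-- What a site reports when it reads a block in state `a` with noise `x`. Block states are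
`0` (empty), `1` (not empty) and `2` (unknown); unknown sites are reported as `2`. -/
def respond (a x : Fin 3) : Fin 3 :=
  if x = 2 then (if a = 0 then 1 else if a = 1 then 0 else 2) else x

/-- The state of a block whose two sites are in states `a` and `b`: three-valued disjunction. -/
def merge (a b : Fin 3) : Fin 3 :=
  if a = 1 ∨ b = 1 then 1 else if a = 0 ∧ b = 0 then 0 else 2

/-- One step of the envelope process: the evolution of partially known blocks. The sites `2k` and
`2k + 1` of the new `k`-th block read the blocks `k` and `k + 1`. -/
def envelope (v : ℤ → Fin 3) (ω : ℤ → Fin 3) (k : ℤ) : Fin 3 :=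
  merge (respond (v k) (ω (2 * k))) (respond (v (k + 1)) (ω (2 * k + 1)))

lemma merge_comm (a b : Fin 3) : merge a b = merge b a := by
  revert a b
  decide

lemma isLocalMap_envelope : IsLocalMap envelope := by
  refine ⟨fun k => {k, k + 1, 2 * k, 2 * k + 1}, fun k v v' ω ω' h h' => ?_⟩
  simp only [envelope]
  rw [h k (by simp), h (k + 1) (by simp), h' (2 * k) (by simp), h' (2 * k + 1) (by simp)]

/-- The block `k` of the configuration `η` as a state of the envelope process. -/
def blockState (η : ℤ → Fin 2) (k : ℤ) : Fin 3 :=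
  if emptyBlock η k then 0 else 1

/-- All known blocks of `v` agree with `η`. -/
def Compatible (η : ℤ → Fin 2) (v : ℤ → Fin 3) : Prop :=
  ∀ k, v k = 2 ∨ v k = blockState η k

lemma Compatible.step {η : ℤ → Fin 2} {v : ℤ → Fin 3} (h : Compatible η v) (ω : ℤ → Fin 3) :
    Compatible (step η ω) (envelope v ω) := by
  intro k
  have e1 : (2 * k + 1) / 2 = k := by omega
  have e2 : (2 * k + 1 + 1) / 2 = k + 1 := by omega
  have h1 := h k
  have h2 := h (k + 1)
  simp only [blockState] at h1 h2
  simp only [blockState, envelope, emptyBlock, ParityGPCA.step, e1, e2]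
  rw [show decide (η (2 * k) = 0 ∧ η (2 * k + 1) = 0) = emptyBlock η k from rfl,
    show decide (η (2 * (k + 1)) = 0 ∧ η (2 * (k + 1) + 1) = 0) = emptyBlock η (k + 1) from rfl]
  generalize emptyBlock η k = b at *
  generalize emptyBlock η (k + 1) = c at *
  generalize v k = x at *
  generalize v (k + 1) = y at *
  generalize ω (2 * k) = u
  generalize ω (2 * k + 1) = w
  revert b c x y u w
  decide

/-- After one step a local function only depends on finitely many block states, so that its
oscillation is controlled by the number of unknown blocks among them. -/
lemma exists_average_sub_le {g : (ℤ → Fin 2) → ℝ} (hg : IsLocal g) (P : Measure (ℤ → Fin 3)) :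
    ∃ (C : ℝ) (S : Finset ℤ), ∀ η ζ v, Compatible η v → Compatible ζ v →
      |average P step g η - average P step g ζ| ≤
        C * ∑ k ∈ S, if v k = 2 then (1 : ℝ) else 0 := by
  classical
  obtain ⟨C, hC⟩ := (isLocalMap_step.isLocal_average (P := P) hg).exists_abs_le
  have hC0 : 0 ≤ C := (abs_nonneg _).trans (hC fun _ => 0)
  obtain ⟨S, hS⟩ := hg
  refine ⟨2 * C, S.image fun n => (n + 1) / 2, fun η ζ v hη hζ => ?_⟩
  by_cases hv : ∃ k ∈ S.image fun n => (n + 1) / 2, v k = 2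
  · obtain ⟨k, hk, hvk⟩ := hv
    have h1 : (1 : ℝ) ≤ ∑ k ∈ S.image fun n => (n + 1) / 2, if v k = 2 then (1 : ℝ) else 0 := by
      have := Finset.single_le_sum (f := fun k => if v k = 2 then (1 : ℝ) else 0)
        (fun i _ => by positivity) hk
      simpa [hvk] using this
    have h2 := abs_sub (average P step g η) (average P step g ζ)
    nlinarith [hC η, hC ζ]
  · push Not at hv
    have : average P step g η = average P step g ζ := by
      refine integral_congr_ae (ae_of_all _ fun ω => hS fun n hn => ?_)
      have hk := hv _ (Finset.mem_image_of_mem _ (Finset.mem_coe.1 hn))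
      have h1 := ((hη _).resolve_left hk).symm.trans ((hζ _).resolve_left hk)
      have h2 : emptyBlock η ((n + 1) / 2) = emptyBlock ζ ((n + 1) / 2) := by
        simp only [blockState] at h1
        generalize emptyBlock η ((n + 1) / 2) = a at *
        generalize emptyBlock ζ ((n + 1) / 2) = b at *
        revert a b
        decide
      simp only [step, h2]
    rw [this, sub_self, abs_zero]
    positivity

section

variable {p q : ℝ} (h : (p, q) ∈ paramSet)
include h

/-- Domination of oscillations by a function of the envelope is preserved by the dynamics. -/
lemma abs_iterate_average_sub_le {g : (ℤ → Fin 2) → ℝ} {G : (ℤ → Fin 3) → ℝ} (hg : IsLocal g)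
    (hG : IsLocal G) (le : ∀ η ζ v, Compatible η v → Compatible ζ v → |g η - g ζ| ≤ G v) (t : ℕ)
    {η ζ : ℤ → Fin 2} {v : ℤ → Fin 3} (hη : Compatible η v) (hζ : Compatible ζ v) :
    |(average (noise p q) step)^[t] g η - (average (noise p q) step)^[t] g ζ| ≤
      (average (noise p q) envelope)^[t] G v := by
  have := isProbabilityMeasure_noiseLaw h
  induction t generalizing η ζ v with
  | zero => exact le η ζ v hη hζ
  | succ t ih =>
    simp only [Function.iterate_succ_apply']
    have h1 := isLocalMap_step.isLocal_iterate_average (P := noise p q) hg t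
    have h2 := isLocalMap_envelope.isLocal_iterate_average (P := noise p q) hG t
    have i1 := isLocalMap_step.integrable (P := noise p q) h1
    simp only [average]
    rw [← integral_sub (i1 η) (i1 ζ)]
    refine (abs_integral_le_integral_abs).trans (integral_mono ((i1 η).sub (i1 ζ)).abs
      (isLocalMap_envelope.integrable h2 v) fun ω => ?_)
    exact ih (hη.step ω) (hζ.step ω)

end

/-- The mean of `G` over the envelope process at time `t`, started from the totally unknown
configuration. -/
noncomputable def expect (p q : ℝ) (t : ℕ) (G : (ℤ → Fin 3) → ℝ) : ℝ :=
  (average (noise p q) envelope)^[t] G fun _ => 2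

lemma expect_succ (p q : ℝ) (t : ℕ) (G : (ℤ → Fin 3) → ℝ) :
    expect p q (t + 1) G = expect p q t (average (noise p q) envelope G) := rfl

/-- The envelope process is invariant under the reflections of the lattice. -/
lemma average_envelope_reflect {p q : ℝ} (h : (p, q) ∈ paramSet) (G : (ℤ → Fin 3) → ℝ) (c : ℤ)
    (v : ℤ → Fin 3) :
    average (noise p q) envelope (fun w => G fun k => w (c - k)) v =
      average (noise p q) envelope G fun k => v (c + 1 - k) := by
  have := isProbabilityMeasure_noiseLaw h
  -- the noise has to be reflected about the centre of the block exchanged with the block `0`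
  let e : ℤ ≃ ℤ := Equiv.subLeft (2 * c + 1)
  have hmp : MeasurePreserving (MeasurableEquiv.piCongrLeft (fun _ : ℤ => Fin 3) e) (noise p q)
      (noise p q) :=
    ⟨by fun_prop, Measure.infinitePi_map_piCongrLeft (μ := fun _ : ℤ => noiseLaw p q) e⟩
  have he : ∀ (ω : ℤ → Fin 3) n,
      MeasurableEquiv.piCongrLeft (fun _ : ℤ => Fin 3) e ω n = ω (2 * c + 1 - n) := fun ω n => by
    have := MeasurableEquiv.piCongrLeft_apply_apply (β := fun _ : ℤ => Fin 3) e ω (e.symm n)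
    rw [Equiv.apply_symm_apply] at this
    rw [this]
    exact congrArg ω (e.symm_apply_eq.2 (by simp [e]))
  simp only [average]
  rw [← hmp.integral_comp (MeasurableEquiv.measurableEmbedding _)]
  refine integral_congr_ae (ae_of_all _ fun ω => congrArg G (funext fun k => ?_))
  simp only [envelope, he]
  rw [merge_comm]
  congr 3 <;> ring

lemma expect_reflect {p q : ℝ} (h : (p, q) ∈ paramSet) (t : ℕ) (G : (ℤ → Fin 3) → ℝ) (c : ℤ) :
    expect p q t (fun v => G fun k => v (c - k)) = expect p q t G := by
  induction t generalizing G c with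
  | zero => rfl
  | succ t ih =>
    rw [expect_succ, expect_succ, funext fun v => average_envelope_reflect h G c v, ih]

/-- If the density of unknown blocks tends to `0`, the automaton is ergodic. -/
theorem isErgodic_of_tendsto_expect {p q : ℝ} (h : (p, q) ∈ paramSet)
    (hd : Tendsto (fun t => expect p q t fun v => if v 0 = 2 then 1 else 0) atTop (𝓝 0)) :
    (gpcaE p q h).IsErgodic := by
  have := isProbabilityMeasure_noiseLaw h
  refine isErgodic_of_oscillation (gpcaE p q h) isLocalMap_step (configLaw_gpcaE h)
    measurable_step fun g hg => ?_
  obtain ⟨C, S, hCS⟩ := exists_average_sub_le hg (noise p q)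
  have hl : ∀ k : ℤ, IsLocal fun v : ℤ → Fin 3 => if v k = 2 then (1 : ℝ) else 0 :=
    fun k => isLocal_eval (fun a => if a = 2 then (1 : ℝ) else 0) k
  have hu : ∀ η, Compatible η fun _ => 2 := fun η k => .inl rfl
  -- all blocks have the same density, by invariance under reflections
  have hshift : ∀ t k, expect p q t (fun v => if v k = 2 then 1 else 0) =
      expect p q t fun v => if v 0 = 2 then 1 else 0 := fun t k => by
    rw [← expect_reflect h t (fun v => if v k = 2 then 1 else 0) k]
    simp
  obtain ⟨D, hD⟩ := hg.exists_abs_le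
  have key : ∀ t η ζ, |(average (noise p q) step)^[t + 1] g η -
      (average (noise p q) step)^[t + 1] g ζ| ≤
        C * (S.card * expect p q t fun v => if v 0 = 2 then 1 else 0) := fun t η ζ => by
    have := abs_iterate_average_sub_le h (isLocalMap_step.isLocal_average (P := noise p q) hg)
      ((IsLocal.sum S hl).const_mul C) hCS t (hu η) (hu ζ)
    rw [iterate_average_const_mul, iterate_average_sum isLocalMap_envelope S hl] at this
    simp only [Function.iterate_succ_apply]
    refine this.trans_eq ?_
    rw [← nsmul_eq_mul, ← Finset.sum_const]
    exact congrArg (C * ·) (Finset.sum_congr rfl fun k _ => hshift t k)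
  refine ⟨fun t => t.casesOn (2 * D)
    fun t => C * (S.card * expect p q t fun v => if v 0 = 2 then 1 else 0), ?_, fun t => ?_⟩
  · rw [← tendsto_add_atTop_iff_nat 1]
    simpa using (hd.const_mul (S.card : ℝ)).const_mul C
  · cases t with
    | zero =>
      intro η ζ
      have := abs_sub (g η) (g ζ)
      change |g η - g ζ| ≤ 2 * D
      linarith [hD η, hD ζ]
    | succ t => exact key t

/-! ### Block probabilities of the envelope process -/

/-- The probability that a block of the envelope process gets the state `c` when it reads blocks in
the states `a` and `b`. -/
noncomputable def transition (p q : ℝ) (a b c : Fin 3) : ℝ :=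
  ∫ x, ∫ y, (if merge (respond a x) (respond b y) = c then 1 else 0) ∂noiseLaw p q ∂noiseLaw p q

section

variable {p q : ℝ} (h : (p, q) ∈ paramSet)
include h

lemma average_indicator (c : Fin 3) (k : ℤ) (v : ℤ → Fin 3) :
    average (noise p q) envelope (fun w => if w k = c then 1 else 0) v =
      transition p q (v k) (v (k + 1)) c := by
  have := isProbabilityMeasure_noiseLaw h
  have hmap := Measure.infinitePi_map_eval_prod (P := fun _ : ℤ => noiseLaw p q)
    (i := 2 * k) (j := 2 * k + 1) (by omega)
  have hf : Measurable fun x : Fin 3 × Fin 3 =>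
      if merge (respond (v k) x.1) (respond (v (k + 1)) x.2) = c then (1 : ℝ) else 0 :=
    measurable_of_countable _
  have hi : Integrable (fun x : Fin 3 × Fin 3 =>
      if merge (respond (v k) x.1) (respond (v (k + 1)) x.2) = c then (1 : ℝ) else 0)
      ((noiseLaw p q).prod (noiseLaw p q)) := .of_finite
  rw [transition, ← integral_prod _ hi, ← hmap, integral_map (by fun_prop)
    hf.aestronglyMeasurable]
  rfl

lemma average_indicator₂ (a b : Fin 3) (v : ℤ → Fin 3) :
    average (noise p q) envelope (fun w => if w 0 = a ∧ w 1 = b then 1 else 0) v =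
      transition p q (v 0) (v 1) a * transition p q (v 1) (v 2) b := by
  have := isProbabilityMeasure_noiseLaw h
  have d0 : DependsOn (fun ω => if envelope v ω 0 = a then (1 : ℝ) else 0)
      (({0, 1} : Finset ℤ) : Set ℤ) := fun ω ω' e => by
    simp [envelope, e 0, e 1]
  have d1 : DependsOn (fun ω => if envelope v ω 1 = b then (1 : ℝ) else 0)
      (({2, 3} : Finset ℤ) : Set ℤ) := fun ω ω' e => by
    simp [envelope, e 2, e 3]
  have a0 : average (noise p q) envelope (fun w => if w 0 = a then 1 else 0) v =
      transition p q (v 0) (v 1) a := average_indicator h a 0 v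
  have a1 : average (noise p q) envelope (fun w => if w 1 = b then 1 else 0) v =
      transition p q (v 1) (v 2) b := average_indicator h b 1 v
  rw [← a0, ← a1]
  refine Eq.trans ?_ (integral_mul_of_dependsOn_disjoint (noiseLaw p q) d0 d1 (by decide))
  simp only [average, ite_and, ite_mul, one_mul, zero_mul]

lemma average_indicator₃ (a b c : Fin 3) (v : ℤ → Fin 3) :
    average (noise p q) envelope (fun w => if w 0 = a ∧ w 1 = b ∧ w 2 = c then 1 else 0) v =
      transition p q (v 0) (v 1) a * transition p q (v 1) (v 2) b *
        transition p q (v 2) (v 3) c := by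
  have := isProbabilityMeasure_noiseLaw h
  have d0 : DependsOn (fun ω => if envelope v ω 0 = a ∧ envelope v ω 1 = b then (1 : ℝ) else 0)
      (({0, 1, 2, 3} : Finset ℤ) : Set ℤ) := fun ω ω' e => by
    simp [envelope, e 0, e 1, e 2, e 3]
  have d1 : DependsOn (fun ω => if envelope v ω 2 = c then (1 : ℝ) else 0)
      (({4, 5} : Finset ℤ) : Set ℤ) := fun ω ω' e => by
    have : envelope v ω 2 = envelope v ω' 2 := by simp [envelope, e 4, e 5]
    simp only [this]
  have a2 : average (noise p q) envelope (fun w => if w 2 = c then 1 else 0) v =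
      transition p q (v 2) (v 3) c := average_indicator h c 2 v
  rw [← average_indicator₂ h, ← a2]
  refine Eq.trans ?_ (integral_mul_of_dependsOn_disjoint (noiseLaw p q) d0 d1 (by decide))
  simp only [average, ← and_assoc, ite_and (_ ∧ _), ite_mul, one_mul, zero_mul]

lemma transition_two_le (a b : Fin 3) :
    transition p q a b 2 ≤
      (1 - p - q) * (1 - q) * ((if a = 2 then 1 else 0) + if b = 2 then 1 else 0) := by
  have hh := h
  obtain ⟨⟨hp, -⟩, ⟨hq, -⟩, -, hr⟩ := h
  simp only at hp hq hr
  have h1 : 0 ≤ (1 - p - q) * (1 - p - q) := mul_self_nonneg _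
  have h2 : 0 ≤ p * (1 - p - q) := mul_nonneg hp (by linarith)
  simp only [transition, integral_noiseLaw hh]
  fin_cases a <;> fin_cases b <;> simp [merge, respond] <;> nlinarith

/-- The probability that the blocks `0`, `1`, `2` of the envelope process at time `t` have the
states `a`, `b`, `c`. -/
noncomputable def blockProb (p q : ℝ) (t : ℕ) (a b c : Fin 3) : ℝ :=
  expect p q t fun v => if v 0 = a ∧ v 1 = b ∧ v 2 = c then 1 else 0

lemma expect_eq_sum (t : ℕ) (f : Fin 3 → Fin 3 → Fin 3 → ℝ) :
    expect p q t (fun v => f (v 0) (v 1) (v 2)) =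
      ∑ a, ∑ b, ∑ c, f a b c * blockProb p q t a b c := by
  have := isProbabilityMeasure_noiseLaw h
  have hl : ∀ x : Fin 3 × Fin 3 × Fin 3, IsLocal fun v : ℤ → Fin 3 =>
      if v 0 = x.1 ∧ v 1 = x.2.1 ∧ v 2 = x.2.2 then (1 : ℝ) else 0 := fun x =>
    isLocal_eval₃ (fun a b c => if a = x.1 ∧ b = x.2.1 ∧ c = x.2.2 then (1 : ℝ) else 0) 0 1 2
  have e : (fun v : ℤ → Fin 3 => f (v 0) (v 1) (v 2)) = fun v =>
      ∑ x : Fin 3 × Fin 3 × Fin 3, f x.1 x.2.1 x.2.2 *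
        if v 0 = x.1 ∧ v 1 = x.2.1 ∧ v 2 = x.2.2 then (1 : ℝ) else 0 := by
    funext v
    rw [Finset.sum_eq_single (v 0, v 1, v 2)]
    · simp
    · rintro ⟨a, b, c⟩ - hne
      rw [if_neg, mul_zero]
      rintro ⟨rfl, rfl, rfl⟩
      exact hne rfl
    · simp
  rw [e, expect, iterate_average_sum isLocalMap_envelope _ fun x => (hl x).const_mul _]
  simp only [iterate_average_const_mul, Fintype.sum_prod_type]
  rfl

lemma expect_mono (t : ℕ) {G H : (ℤ → Fin 3) → ℝ} (hG : IsLocal G) (hH : IsLocal H)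
    (le : ∀ v, G v ≤ H v) : expect p q t G ≤ expect p q t H := by
  have := isProbabilityMeasure_noiseLaw h
  exact iterate_average_mono isLocalMap_envelope hG hH le t _

lemma blockProb_nonneg (t : ℕ) (a b c : Fin 3) : 0 ≤ blockProb p q t a b c := by
  have h0 := expect_eq_sum h t fun _ _ _ => 0
  simp only [zero_mul, Finset.sum_const_zero] at h0
  rw [← h0]
  refine expect_mono h t (isLocal_eval₃ (fun _ _ _ => 0) 0 1 2) (isLocal_eval₃
    (fun x y z => if x = a ∧ y = b ∧ z = c then (1 : ℝ) else 0) 0 1 2) fun v => ?_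
  positivity

lemma blockProb_reverse (t : ℕ) (a b c : Fin 3) :
    blockProb p q t a b c = blockProb p q t c b a := by
  rw [blockProb, ← expect_reflect h t _ 2, blockProb]
  congr 1
  funext v
  simp only [sub_zero, show (2 : ℤ) - 1 = 1 from rfl, sub_self]
  congr 1
  exact propext ⟨fun ⟨x, y, z⟩ => ⟨z, y, x⟩, fun ⟨x, y, z⟩ => ⟨z, y, x⟩⟩

lemma sum_blockProb_swap (t : ℕ) (a b : Fin 3) :
    ∑ c, blockProb p q t a b c = ∑ c, blockProb p q t b a c := by
  have key : ∀ a b : Fin 3, ∑ c, blockProb p q t a b c =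
      expect p q t fun v => if v 0 = a ∧ v 1 = b then 1 else 0 := fun a b => by
    rw [expect_eq_sum h t fun x y _ => if x = a ∧ y = b then 1 else 0]
    simp [ite_and]
  rw [key, key, ← expect_reflect h t _ 1]
  congr 1
  funext v
  simp only [sub_zero, sub_self, and_comm]

end

/-- The density of unknown blocks in the envelope process at time `t`. -/
noncomputable def unknownDensity (p q : ℝ) (t : ℕ) : ℝ :=
  expect p q t fun v => if v 0 = 2 then 1 else 0

lemma unknownDensity_eq_sum {p q : ℝ} (h : (p, q) ∈ paramSet) (t : ℕ) :
    unknownDensity p q t = ∑ b, ∑ c, blockProb p q t 2 b c := by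
  rw [unknownDensity, expect_eq_sum h t fun x _ _ => if x = 2 then 1 else 0]
  simp [Fin.sum_univ_three]

lemma unknownDensity_nonneg {p q : ℝ} (h : (p, q) ∈ paramSet) (t : ℕ) :
    0 ≤ unknownDensity p q t := by
  rw [unknownDensity_eq_sum h]
  exact Finset.sum_nonneg fun b _ => Finset.sum_nonneg fun c _ => blockProb_nonneg h t 2 b c

/-! ### Contraction of the density of unknown blocks -/

/-- A new block is unknown only if it reads an unknown block, and each unknown block makes each of
its two readers unknown with probability at most `(1 - p - q) * (1 - q)`. -/
lemma unknownDensity_succ_le {p q : ℝ} (h : (p, q) ∈ paramSet) (t : ℕ) :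
    unknownDensity p q (t + 1) ≤ 2 * (1 - p - q) * (1 - q) * unknownDensity p q t := by
  have hl : IsLocal fun v : ℤ → Fin 3 => if v 0 = 2 then (1 : ℝ) else 0 :=
    isLocal_eval (fun a => if a = 2 then (1 : ℝ) else 0) 0
  have h1 : unknownDensity p q (t + 1) ≤ expect p q t fun v =>
      (1 - p - q) * (1 - q) * ((if v 0 = 2 then 1 else 0) + if v 1 = 2 then 1 else 0) := by
    rw [unknownDensity, expect_succ]
    refine expect_mono h t (isLocalMap_envelope.isLocal_average hl) (isLocal_eval₃ (fun a b _ =>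
      (1 - p - q) * (1 - q) * ((if a = 2 then 1 else 0) + if b = 2 then 1 else 0)) 0 1 2)
      fun v => ?_
    rw [average_indicator h]
    exact transition_two_le h _ _
  refine h1.trans_eq ?_
  have s0 := sum_blockProb_swap h t 2 0
  have s1 := sum_blockProb_swap h t 2 1
  rw [expect_eq_sum h t fun a b _ =>
    (1 - p - q) * (1 - q) * ((if a = 2 then 1 else 0) + if b = 2 then 1 else 0),
    unknownDensity_eq_sum h]
  simp [Fin.sum_univ_three] at s0 s1 ⊢
  linear_combination -((1 - p - q) * (1 - q)) * (s0 + s1)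

lemma isErgodic_of_contraction {p q : ℝ} (h : (p, q) ∈ paramSet)
    (hc : 2 * (1 - p - q) * (1 - q) < 1) : (gpcaE p q h).IsErgodic := by
  refine isErgodic_of_tendsto_expect h ?_
  have hc0 : 0 ≤ 2 * (1 - p - q) * (1 - q) := by
    obtain ⟨⟨hp, -⟩, ⟨hq, hq1⟩, -, hr⟩ := h
    simp only at hp hq hr hq1
    have := mul_nonneg (by linarith : 0 ≤ 1 - p - q) (by linarith : 0 ≤ 1 - q)
    linarith
  have hb : ∀ t, unknownDensity p q t ≤
      (2 * (1 - p - q) * (1 - q)) ^ t * unknownDensity p q 0 := fun t => by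
    induction t with
    | zero => simp
    | succ t ih =>
      rw [pow_succ', mul_assoc]
      exact (unknownDensity_succ_le h t).trans (mul_le_mul_of_nonneg_left ih hc0)
  refine squeeze_zero (unknownDensity_nonneg h) hb ?_
  simpa using (tendsto_pow_atTop_nhds_zero_of_lt_one hc0 hc).mul_const (unknownDensity p q 0)

/-! ### A weight function for `q = 0` -/

/-- The probability that the blocks `0` and `1` of the envelope process at time `t` have the
states `a` and `b`. -/
noncomputable def pairProb (p q : ℝ) (t : ℕ) (a b : Fin 3) : ℝ :=
  ∑ c, blockProb p q t a b c

lemma pairProb_eq_expect {p q : ℝ} (h : (p, q) ∈ paramSet) (t : ℕ) (a b : Fin 3) :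
    pairProb p q t a b = expect p q t fun v => if v 0 = a ∧ v 1 = b then 1 else 0 := by
  rw [expect_eq_sum h t fun x y _ => if x = a ∧ y = b then 1 else 0]
  simp [ite_and, pairProb]

section

variable {p : ℝ} (h : (p, 0) ∈ paramSet)
include h

lemma transition_zero_two (a b : Fin 3) :
    transition p 0 a b 2 =
      (1 - p) * if a = 2 ∧ b = 2 then 1 + p else if a = 2 ∨ b = 2 then
        (if a = 0 ∨ b = 0 then p else 1) else 0 := by
  simp only [transition, integral_noiseLaw h]
  fin_cases a <;> fin_cases b <;> simp [merge, respond] <;> ring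

lemma transition_zero_one (a b : Fin 3) :
    transition p 0 a b 1 =
      (1 - p) * if a = 0 ∧ b = 0 then 1 + p else if a = 0 ∨ b = 0 then 1 else 0 := by
  simp only [transition, integral_noiseLaw h]
  fin_cases a <;> fin_cases b <;> simp [merge, respond] <;> ring

lemma transition_zero_zero (a b : Fin 3) :
    transition p 0 a b 0 = (if a = 1 then 1 else p) * if b = 1 then 1 else p := by
  simp only [transition, integral_noiseLaw h]
  fin_cases a <;> fin_cases b <;> simp [merge, respond] <;> ring

lemma unknownDensity_succ_zero (t : ℕ) :
    unknownDensity p 0 (t + 1) = (1 - p) * ((1 + p) * pairProb p 0 t 2 2 +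
      2 * p * pairProb p 0 t 2 0 + 2 * pairProb p 0 t 2 1) := by
  have e : average (noise p 0) envelope (fun v => if v 0 = 2 then 1 else 0) = fun v =>
      transition p 0 (v 0) (v 1) 2 := funext fun v => average_indicator h 2 0 v
  rw [unknownDensity, expect_succ, e, expect_eq_sum h t fun a b _ => transition p 0 a b 2]
  have s0 := sum_blockProb_swap h t 2 0
  have s1 := sum_blockProb_swap h t 2 1
  simp [transition_zero_two h, Fin.sum_univ_three, pairProb] at s0 s1 ⊢
  linear_combination -(p * (1 - p)) * s0 - (1 - p) * s1

lemma pairProb_succ_zero_le (t : ℕ) :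
    pairProb p 0 (t + 1) 2 1 ≤ (1 - p) ^ 2 * ((1 + 2 * p) * pairProb p 0 t 2 0 +
      p ^ 2 * blockProb p 0 t 2 0 0 + blockProb p 0 t 2 1 0) := by
  have hp : 0 ≤ p := h.1.1
  have e : average (noise p 0) envelope (fun v => if v 0 = 2 ∧ v 1 = 1 then 1 else 0) = fun v =>
      transition p 0 (v 0) (v 1) 2 * transition p 0 (v 1) (v 2) 1 :=
    funext fun v => average_indicator₂ h 2 1 v
  rw [pairProb_eq_expect h, expect_succ, e,
    expect_eq_sum h t fun a b c => transition p 0 a b 2 * transition p 0 b c 1]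
  have r1 := blockProb_reverse h t 1 2 0
  have r2 := blockProb_reverse h t 2 2 0
  have s0 := sum_blockProb_swap h t 2 0
  have n1 := mul_nonneg (sq_nonneg (1 - p)) (blockProb_nonneg h t 0 2 0)
  have n2 := mul_nonneg (mul_nonneg (sq_nonneg (1 - p)) hp) (blockProb_nonneg h t 0 2 1)
  simp [transition_zero_two h, transition_zero_one h, Fin.sum_univ_three, pairProb] at s0 ⊢
  rw [r1, r2]
  linear_combination n1 + n2 - (1 - p) ^ 2 * (1 + p) * s0

lemma blockProb_succ_zero_le (t : ℕ) :
    blockProb p 0 (t + 1) 2 1 0 ≤ (1 - p) ^ 2 * p * ((1 + p) * pairProb p 0 t 2 0 +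
      p * (1 + p) * blockProb p 0 t 2 0 0 + blockProb p 0 t 2 0 1 + p * blockProb p 0 t 2 0 2 +
      blockProb p 0 t 2 1 0) := by
  have hp : 0 ≤ p := h.1.1
  have hp1 : p ≤ 1 := h.1.2
  have e : average (noise p 0) envelope (fun v => if v 0 = 2 ∧ v 1 = 1 ∧ v 2 = 0 then 1 else 0) =
      fun v => transition p 0 (v 0) (v 1) 2 * transition p 0 (v 1) (v 2) 1 *
        transition p 0 (v 2) (v 3) 0 := funext fun v => average_indicator₃ h 2 1 0 v
  have hl : IsLocal (average (noise p 0) envelope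
      fun v => if v 0 = 2 ∧ v 1 = 1 ∧ v 2 = 0 then 1 else 0) :=
    isLocalMap_envelope.isLocal_average (isLocal_eval₃
      (fun a b c => if a = 2 ∧ b = 1 ∧ c = 0 then (1 : ℝ) else 0) 0 1 2)
  -- forgetting the fourth block costs little, and leaves a function of three blocks
  have hle : expect p 0 t (average (noise p 0) envelope
        fun v => if v 0 = 2 ∧ v 1 = 1 ∧ v 2 = 0 then 1 else 0) ≤
      expect p 0 t fun v => transition p 0 (v 0) (v 1) 2 * transition p 0 (v 1) (v 2) 1 *
        if v 2 = 1 then 1 else p := by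
    refine expect_mono h t hl (isLocal_eval₃ (fun a b c => transition p 0 a b 2 *
      transition p 0 b c 1 * if c = 1 then 1 else p) 0 1 2) fun v => ?_
    rw [e]
    have h2 : 0 ≤ transition p 0 (v 0) (v 1) 2 := by
      rw [transition_zero_two h]
      exact mul_nonneg (by linarith) (by positivity)
    have h1 : 0 ≤ transition p 0 (v 1) (v 2) 1 := by
      rw [transition_zero_one h]
      exact mul_nonneg (by linarith) (by positivity)
    refine mul_le_mul_of_nonneg_left ?_ (mul_nonneg h2 h1)
    rw [transition_zero_zero h]
    refine mul_le_of_le_one_right (by positivity) ?_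
    split_ifs <;> linarith
  rw [blockProb, expect_succ]
  refine hle.trans ?_
  rw [expect_eq_sum h t fun a b c => transition p 0 a b 2 * transition p 0 b c 1 *
    if c = 1 then 1 else p]
  have r1 := blockProb_reverse h t 1 2 0
  have r2 := blockProb_reverse h t 2 2 0
  have s0 := sum_blockProb_swap h t 2 0
  have n1 := mul_nonneg (mul_nonneg (sq_nonneg (1 - p)) hp) (blockProb_nonneg h t 0 2 0)
  have n2 := mul_nonneg (mul_nonneg (sq_nonneg (1 - p)) (mul_nonneg hp hp))
    (blockProb_nonneg h t 0 2 1)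
  simp [transition_zero_two h, transition_zero_one h, Fin.sum_univ_three, pairProb] at s0 ⊢
  rw [r1, r2]
  linear_combination n1 + n2 - (1 - p) ^ 2 * p * (1 + p) * s0

/-- For `q = 0`, `0.2145 < p` and `p ≤ 1 / 2`, the weight
`P(?) + α P(?1) + β P(?10)` with `α = 1.01 - 2p` and `β = 1 / 2` decreases at each step by at
least a constant multiple of the density of unknown blocks. -/
lemma exists_weight_decrease (hp : 0.2145 < p) (hp' : p ≤ 1 / 2) :
    ∃ δ > 0, ∀ t,
      unknownDensity p 0 (t + 1) + (1.01 - 2 * p) * pairProb p 0 (t + 1) 2 1 +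
          1 / 2 * blockProb p 0 (t + 1) 2 1 0 ≤
        unknownDensity p 0 t + (1.01 - 2 * p) * pairProb p 0 t 2 1 +
          1 / 2 * blockProb p 0 t 2 1 0 - δ * unknownDensity p 0 t := by
  refine ⟨0.001, by norm_num, fun t => ?_⟩
  have hd : unknownDensity p 0 t =
      pairProb p 0 t 2 0 + pairProb p 0 t 2 1 + pairProb p 0 t 2 2 := by
    rw [unknownDensity_eq_sum h, Fin.sum_univ_three]
    rfl
  have h2 := mul_le_mul_of_nonneg_left (pairProb_succ_zero_le h t)
    (by linarith : (0 : ℝ) ≤ 1.01 - 2 * p)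
  have h3 := blockProb_succ_zero_le h t
  rw [unknownDensity_succ_zero h, hd]
  have b0 : pairProb p 0 t 2 0 =
      blockProb p 0 t 2 0 0 + blockProb p 0 t 2 0 1 + blockProb p 0 t 2 0 2 := by
    simp [pairProb, Fin.sum_univ_three]
  have c0 : pairProb p 0 t 2 1 =
      blockProb p 0 t 2 1 0 + (blockProb p 0 t 2 1 1 + blockProb p 0 t 2 1 2) := by
    simp [pairProb, Fin.sum_univ_three, add_assoc]
  have nA : 0 ≤ pairProb p 0 t 2 2 := Finset.sum_nonneg fun c _ => blockProb_nonneg h t 2 2 c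
  have nC : 0 ≤ blockProb p 0 t 2 1 1 + blockProb p 0 t 2 1 2 :=
    add_nonneg (blockProb_nonneg h t 2 1 1) (blockProb_nonneg h t 2 1 2)
  have nB0 := blockProb_nonneg h t 2 0 0
  have nB1 := blockProb_nonneg h t 2 0 1
  have nB2 := blockProb_nonneg h t 2 0 2
  have nC0 := blockProb_nonneg h t 2 1 0
  rw [b0] at h2 h3 ⊢
  rw [c0]
  generalize pairProb p 0 (t + 1) 2 1 = C' at *
  generalize blockProb p 0 (t + 1) 2 1 0 = D' at *
  generalize pairProb p 0 t 2 2 = A at *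
  generalize blockProb p 0 t 2 0 0 = B0 at *
  generalize blockProb p 0 t 2 0 1 = B1 at *
  generalize blockProb p 0 t 2 0 2 = B2 at *
  generalize blockProb p 0 t 2 1 0 = C0 at *
  generalize blockProb p 0 t 2 1 1 + blockProb p 0 t 2 1 2 = C at *
  have m1 := mul_nonneg (sub_nonneg.2 hp.le) (sub_nonneg.2 hp')
  have m2 := mul_nonneg m1 (sub_nonneg.2 hp.le)
  have m3 := mul_nonneg m1 (sq_nonneg p)
  -- coefficients of `P(??)`, `P(?11) + P(?1?)`, `P(?10)`, `P(?01)`, `P(?0?)`, `P(?00)` after and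
  -- before the step, with `0.999 = 1 - δ`: the second one forces `α > 1 - 2p`, and with this `α` the
  -- fourth one is tight for `p` near `0.2145`
  have kA : (1 - p) * (1 + p) ≤ 0.999 := by nlinarith
  have kC : (1 - p) * 2 ≤ 0.999 + (1.01 - 2 * p) := by nlinarith
  have kC0 : (1 - p) * 2 + (1.01 - 2 * p) * (1 - p) ^ 2 + 1 / 2 * ((1 - p) ^ 2 * p) ≤
      0.999 + (1.01 - 2 * p) + 1 / 2 := by
    nlinarith [m1, m2]
  have kB1 : (1 - p) * (2 * p) + (1.01 - 2 * p) * ((1 - p) ^ 2 * (1 + 2 * p)) +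
      1 / 2 * ((1 - p) ^ 2 * p * (1 + p + 1)) ≤ 0.999 := by
    nlinarith [m1, m2, m3, sq_nonneg (p * (p - 0.4))]
  have kB2 : (1 - p) * (2 * p) + (1.01 - 2 * p) * ((1 - p) ^ 2 * (1 + 2 * p)) +
      1 / 2 * ((1 - p) ^ 2 * p * (1 + p + p)) ≤ 0.999 := by
    have : (1 - p) ^ 2 * p * (1 + p + p) ≤ (1 - p) ^ 2 * p * (1 + p + 1) := by
      gcongr
      linarith
    linarith
  have kB0 : (1 - p) * (2 * p) + (1.01 - 2 * p) * ((1 - p) ^ 2 * (1 + 2 * p + p ^ 2)) +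
      1 / 2 * ((1 - p) ^ 2 * p * (1 + p + p * (1 + p))) ≤ 0.999 := by
    nlinarith [m1, m2, m3, sq_nonneg (p * (p - 0.4))]
  linear_combination h2 + 1 / 2 * h3 + mul_le_mul_of_nonneg_right kA nA +
    mul_le_mul_of_nonneg_right kC nC + mul_le_mul_of_nonneg_right kC0 nC0 +
    mul_le_mul_of_nonneg_right kB0 nB0 + mul_le_mul_of_nonneg_right kB1 nB1 +
    mul_le_mul_of_nonneg_right kB2 nB2

lemma isErgodic_of_weight (hp : 0.2145 < p) (hp' : p ≤ 1 / 2) : (gpcaE p 0 h).IsErgodic := by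
  refine isErgodic_of_tendsto_expect h ?_
  change Tendsto (unknownDensity p 0) atTop (𝓝 0)
  obtain ⟨δ, hδ, hW⟩ := exists_weight_decrease h hp hp'
  set W : ℕ → ℝ := fun t => unknownDensity p 0 t + (1.01 - 2 * p) * pairProb p 0 t 2 1 +
    1 / 2 * blockProb p 0 t 2 1 0 with hWdef
  have hW0 : ∀ t, 0 ≤ W t := fun t => by
    have h1 := unknownDensity_nonneg h t
    have h2 : 0 ≤ pairProb p 0 t 2 1 := Finset.sum_nonneg fun c _ => blockProb_nonneg h t 2 1 c
    have h3 := blockProb_nonneg h t 2 1 0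
    have h4 := mul_nonneg (by linarith : (0 : ℝ) ≤ 1.01 - 2 * p) h2
    simp only [hWdef]
    linarith
  have hsum : ∀ n, δ * ∑ t ∈ Finset.range n, unknownDensity p 0 t ≤ W 0 - W n := fun n => by
    induction n with
    | zero => simp
    | succ n ih =>
      rw [Finset.sum_range_succ, mul_add]
      have := hW n
      simp only [hWdef] at ih ⊢
      linarith
  refine (summable_of_sum_range_le (c := W 0 / δ) (unknownDensity_nonneg h)
    fun n => ?_).tendsto_atTop_zero
  rw [le_div_iff₀' hδ]
  linarith [hsum n, hW0 n]

end

/-! ### The threshold polynomial -/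

lemma strictMono_thresholdPolynomial :
    StrictMono fun x : ℝ => x ^ 5 - 5 * x ^ 4 + 9 * x ^ 3 - 8 * x ^ 2 + 6 * x - 1 := by
  refine strictMono_of_deriv_pos fun x => ?_
  have : HasDerivAt (fun x : ℝ => x ^ 5 - 5 * x ^ 4 + 9 * x ^ 3 - 8 * x ^ 2 + 6 * x - 1)
      (5 * x ^ 4 - 5 * (4 * x ^ 3) + 9 * (3 * x ^ 2) - 8 * (2 * x) + 6) x := by
    have h := (((((hasDerivAt_pow 5 x).sub ((hasDerivAt_pow 4 x).const_mul 5)).add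
      ((hasDerivAt_pow 3 x).const_mul 9)).sub ((hasDerivAt_pow 2 x).const_mul 8)).add
      ((hasDerivAt_id x).const_mul 6)).sub_const 1
    simpa using h
  rw [this.deriv]
  -- in terms of `y = x - 1` the derivative is `5 y ^ 4 - 3 y ^ 2 - 2 y + 2`
  nlinarith [sq_nonneg ((x - 1) ^ 2 - 0.42), sq_nonneg (x - 1 - 0.65), sq_nonneg (x - 1)]

lemma exists_root_thresholdPolynomial :
    ∃ x ∈ Set.Ioo (0.2145 : ℝ) 0.2155,
      x ^ 5 - 5 * x ^ 4 + 9 * x ^ 3 - 8 * x ^ 2 + 6 * x - 1 = 0 := by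
  refine intermediate_value_Ioo (by norm_num) (f := fun x : ℝ =>
    x ^ 5 - 5 * x ^ 4 + 9 * x ^ 3 - 8 * x ^ 2 + 6 * x - 1) (by fun_prop) ?_
  constructor <;> norm_num

end ParityGPCA

open ParityGPCA

theorem theorem1 :
    (∃ p₀ : ℝ,
      (∀ x : ℝ, x ^ 5 - 5 * x ^ 4 + 9 * x ^ 3 - 8 * x ^ 2 + 6 * x - 1 = 0 ↔ x = p₀) ∧
      |p₀ - 0.215| < 0.0005 ∧
      ∀ (p : ℝ) (h : (p, 0) ∈ paramSet), p₀ < p → (gpcaE p 0 h).IsErgodic) ∧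
    (∀ (p q : ℝ) (h : (p, q) ∈ paramSet),
      max ((2 - p - √(p ^ 2 + 2)) / 2) 0 < q → (gpcaE p q h).IsErgodic) := by
  constructor
  · obtain ⟨p₀, ⟨hl, hu⟩, h0⟩ := exists_root_thresholdPolynomial
    refine ⟨p₀, fun x => ⟨fun hx => ?_, fun hx => hx ▸ h0⟩, ?_, fun p h hp => ?_⟩
    · exact strictMono_thresholdPolynomial.injective (hx.trans h0.symm)
    · rw [abs_lt]
      constructor <;> linarith
    · rcases le_or_gt p (1 / 2) with hp' | hp'
      · exact isErgodic_of_weight h (hl.trans hp) hp'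
      · exact isErgodic_of_contraction h (by linarith)
  · intro p q h hq
    refine isErgodic_of_contraction h ?_
    obtain ⟨⟨hp, -⟩, -, -, hr⟩ := h
    simp only at hp hr
    have h1 := (le_max_left _ _).trans_lt hq
    have h2 := Real.sq_sqrt (by positivity : 0 ≤ p ^ 2 + 2)
    have h3 := Real.sqrt_nonneg (p ^ 2 + 2)
    -- `2 (1 - p - q) (1 - q) < 1` is equivalent to `2 (1 - q) < p + √(p ^ 2 + 2)`
    nlinarith
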